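/- Let $M$ be a Garside monoid, that is, a finitely generated, left and right cancellative monoid such that: $M$ is atomic (it is generated by its atoms, the elements $a\ne 1$ for which $a=bc$ implies $b=1$ or $c=1$, and for every $a\in M$ the supremum $\|a\|$ of the lengths of all expressions of $a$ as a product of atoms is finite); $M$ is a lattice both for left divisibility $\le_L$ ($a\le_L b$ iff $ac=b$ for some $c\in M$) and for right divisibility $\le_R$ ($a\le_R b$ iff $ca=b$ for some $c\in M$); and $M$ has a Garside element, that is, an element $\Delta$ whose left divisors coincide with its right divisors and generate $M$. Let $G$ be the group of fractions of $M$, with $M\subseteq G$, and assume that $G$ is nontrivial. Fix a Garside element $\Delta$ of $M$, let $\mathcal D=\{a\in M: a\le_L\Delta\}$ be the set of simple elements, and let $N=\|\Delta\|$. For $g,h\in G$ write $g\le_L h$ if $gc=h$ for some $c\in M$, and let $\inf(g)=\max\{r\in\mathbb Z:\Delta^r\le_L g\}$ and $\sup(g)=\min\{s\in\mathbb Z: g\le_L\Delta^s\}$. The super summit set of $g$ is the set of all $h$ in the conjugacy class $[g]$ of $g$ such that $\inf(h)=\max\{\inf(x):x\in[g]\}$ and $\sup(h)=\min\{\sup(x):x\in[g]\}$.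 Let $|g|_{\mathcal D}$ be the shortest length of a word in $\mathcal D\cup\mathcal D^{-1}$ representing $g$. **Theorem.** For every $g\in G$ there is a positive integer $n\le N^2$ such that every element $h$ of the super summit set of $g^n$ is periodically geodesic with respect to $\mathcal D$, i.e. $|h^k|_{\mathcal D}=|k|\cdot|h|_{\mathcal D}$ for all integers $k$. -/

import Mathlib

open scoped Pointwise

namespace Garside

section Monoid

variable {M : Type*} [Monoid M]

/-- An atom: an element `a ≠ 1` such that `a = b * c` forces `b = 1` or `c = 1`. -/
def IsAtomElt (a : M) : Prop :=
  a ≠ 1 ∧ ∀ b c : M, a = b * c → b = 1 ∨ c = 1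

/-- `‖a‖`: the supremum of the lengths of all expressions of `a` as a product of atoms. -/
noncomputable def norm (a : M) : ℕ∞ :=
  ⨆ l ∈ {l : List M | (∀ x ∈ l, IsAtomElt x) ∧ l.prod = a}, (l.length : ℕ∞)

/-- `a ≤_L b` : `a` is a left divisor of `b`. -/
def LeL (a b : M) : Prop := ∃ c : M, a * c = b

/-- `a ≤_R b` : `a` is a right divisor of `b`. -/
def LeR (a b : M) : Prop := ∃ c : M, c * a = b

/-- Any two elements have a greatest lower bound and a least upper bound for `r`.
(It is applied to `LeL` and `LeR`, which are partial orders on every atomic monoid.) -/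
def IsLatticeRel (r : M → M → Prop) : Prop :=
  (∀ a b : M, ∃ m : M, r m a ∧ r m b ∧ ∀ c : M, r c a → r c b → r c m) ∧
  (∀ a b : M, ∃ m : M, r a m ∧ r b m ∧ ∀ c : M, r a c → r b c → r m c)

/-- A Garside element: its left and right divisors coincide and generate the monoid. -/
structure IsGarsideElement (Δ : M) : Prop where
  left_iff_right : ∀ a : M, LeL a Δ ↔ LeR a Δ
  generates : Submonoid.closure {a : M | LeL a Δ} = ⊤

variable (M) in
/-- An atomic monoid: generated by its atoms, with `‖a‖ < ∞` for every `a`. -/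
structure IsAtomicMonoid : Prop where
  generated : Submonoid.closure {a : M | IsAtomElt a} = ⊤
  norm_lt_top : ∀ a : M, norm a < ⊤

variable (M) in
/-- A Garside monoid. -/
structure IsGarsideMonoid : Prop where
  atomic : IsAtomicMonoid M
  finitely_generated : Monoid.FG M
  left_cancel : ∀ a b c : M, a * b = a * c → b = c
  right_cancel : ∀ a b c : M, b * a = c * a → b = c
  lattice_left : IsLatticeRel (LeL : M → M → Prop)
  lattice_right : IsLatticeRel (LeR : M → M → Prop)
  exists_garside : ∃ Δ : M, IsGarsideElement Δ

end Monoid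

section Group

variable {M G : Type*} [Monoid M] [Group G]

/-- `φ` exhibits `G` as the group of fractions of `M`: it embeds `M` in `G`, and every element
of `G` is a fraction of elements of `M`. -/
structure IsGroupOfFractions (φ : M →* G) : Prop where
  injective : Function.Injective φ
  fraction : ∀ g : G, ∃ a b : M, g = φ a * (φ b)⁻¹

/-- The order `g ≤_L h` on `G` : `g * c = h` for some positive element `c`. -/
def GLeL (φ : M →* G) (g h : G) : Prop := ∃ c : M, g * φ c = h

/-- `inf g = max {r : ℤ | Δ ^ r ≤_L g}` (the set is nonempty and bounded above if `Δ` is a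
Garside element of a nontrivial Garside group). -/
noncomputable def inf (φ : M →* G) (Δ : M) (g : G) : ℤ :=
  sSup {r : ℤ | GLeL φ (φ Δ ^ r) g}

/-- `sup g = min {s : ℤ | g ≤_L Δ ^ s}` (the set is nonempty and bounded below if `Δ` is a
Garside element of a nontrivial Garside group). -/
noncomputable def sup (φ : M →* G) (Δ : M) (g : G) : ℤ :=
  sInf {s : ℤ | GLeL φ g (φ Δ ^ s)}

/-- The super summit set of `g`: the conjugates `h` of `g` for which `inf h` is the maximum of
`inf`, and `sup h` is the minimum of `sup`, over the conjugacy class of `g`. -/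
def superSummitSet (φ : M →* G) (Δ : M) (g : G) : Set G :=
  {h : G | h ∈ conjugatesOf g ∧
    IsGreatest (inf φ Δ '' conjugatesOf g) (inf φ Δ h) ∧
    IsLeast (sup φ Δ '' conjugatesOf g) (sup φ Δ h)}

/-- The set of simple elements, viewed in `G`. -/
def simpleElements (φ : M →* G) (Δ : M) : Set G := φ '' {a : M | LeL a Δ}

/-- The shortest length of a word in `X ∪ X⁻¹` representing `g`, for a set `X` that generates `G`
as a group. -/
noncomputable def wordLength (X : Set G) (g : G) : ℕ :=
  sInf {k : ℕ | ∃ l : List G, (∀ x ∈ l, x ∈ X ∪ X⁻¹) ∧ l.prod = g ∧ l.length = k}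

/-- `g` is periodically geodesic with respect to the group generators `X`. -/
def PeriodicallyGeodesic (X : Set G) (g : G) : Prop :=
  ∀ k : ℤ, wordLength X (g ^ k) = k.natAbs * wordLength X g

end Group

end Garside

/-! Left multiplication `F` by `g` and right multiplication `D` by `φ Δ` are commuting automorphisms
of the semilattice `G` under left divisibility. Since `g ^ n * x ≤ x * Δ ^ r` says exactly that the
conjugate `x⁻¹ * g ^ n * x` has `sup` at most `r`, minimising `sup` over conjugacy classes of powers
becomes a question about how slowly `F ^ n` can move a point compared with `D`.

Strict chains in `[x, D x]` have at most `N` steps, so chains of joins stabilise. This gives two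
facts: an average drift below `r / n` plus a small error yields a point with `F ^ n x ≤ D ^ r x`
(`slopeBound_of_mul_add_one`), and a slope strictly below `r / n` must beat it by `1 / (n * N)`
(`slopeBound_improve`). Hence there is a real `τ` such that the least `sup` on the class of `g ^ n`
is `⌈n * τ⌉`, and the gap with Dirichlet approximation gives `q * τ ∈ ℤ` for some `0 < q ≤ N`
(`exists_slope`).

When `q ∣ n` there is no rounding, so a minimiser `h` of `sup` satisfies `sup (h ^ k) = k * sup h`.
Applying this to `g` and `g⁻¹` gives `q * q' ≤ N ^ 2`, and geodesic length depends only on `sup h`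
and `sup h⁻¹` (`wordLength_simpleElements`). -/

namespace Garside

/-! ### Slopes of automorphisms commuting with a bounded shift -/

section Lattice

variable {L : Type*} [SemilatticeSup L]

/-- An order automorphism `D` that moves every element up, has cofinal orbits, and for which the
strict chains of every interval `[x, D x]` have at most `N` steps. -/
structure IsBoundedShift (D : L ≃o L) (N : ℕ) : Prop where
  lt_apply : ∀ x, x < D x
  cofinal : ∀ x y, ∃ e : ℕ, y ≤ (D ^ e) x
  height : ∀ (x : L) (k : ℕ) (z : ℕ → L),
    (∀ i < k, z i < z (i + 1)) → x ≤ z 0 → z k ≤ D x → k ≤ N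

theorem commute_apply {F D : L ≃o L} (h : Commute F D) (x : L) : F (D x) = D (F x) := by
  rw [← RelIso.mul_apply, h.eq, RelIso.mul_apply]

theorem pow_apply_le_pow_apply {F E : L ≃o L} (h : Commute F E) {x : L} (hx : F x ≤ E x) (k : ℕ) :
    (F ^ k) x ≤ (E ^ k) x := by
  induction k with
  | zero => simp
  | succ k ih =>
    rw [pow_succ' F, pow_succ E, RelIso.mul_apply, RelIso.mul_apply]
    calc F ((F ^ k) x) ≤ F ((E ^ k) x) := F.monotone ih
      _ = (E ^ k) (F x) := commute_apply (h.pow_right k) x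
      _ ≤ _ := (E ^ k).monotone hx

namespace IsBoundedShift

variable {D F : L ≃o L} {N : ℕ}

theorem zpow_apply_mono (hD : IsBoundedShift D N) (x : L) {r s : ℤ} (h : r ≤ s) :
    (D ^ r) x ≤ (D ^ s) x := by
  obtain ⟨k, rfl⟩ := Int.le.dest h
  rw [zpow_add, RelIso.mul_apply, zpow_natCast]
  apply (D ^ r).monotone
  have := pow_apply_le_pow_apply (F := 1) (Commute.one_left D) (hD.lt_apply x).le k
  simpa using this

theorem exists_eq_succ_of_monotone (hD : IsBoundedShift D N) (x : L) {z : ℕ → L} (hz : Monotone z)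
    (h0 : x ≤ z 0) (h1 : z (N + 1) ≤ D x) : ∃ k ≤ N, z (k + 1) = z k := by
  by_contra! h
  have := hD.height x (N + 1) z
    (fun i hi => lt_of_le_of_ne (hz (Nat.le_succ i)) (h i (by omega)).symm) h0 h1
  omega

theorem exists_eq_succ_of_antitone (hD : IsBoundedShift D N) (x : L) {z : ℕ → L} (hz : Antitone z)
    (h0 : z 0 ≤ D x) (h1 : x ≤ z (N + 1)) : ∃ k ≤ N, z (k + 1) = z k := by
  obtain ⟨k, hk, h⟩ := hD.exists_eq_succ_of_monotone x (z := fun i => z (N + 1 - i))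
    (fun i j hij => hz (by omega)) (by simpa using h1) (by simpa using h0)
  refine ⟨N - k, by omega, ?_⟩
  have e1 : N + 1 - (k + 1) = N - k := by omega
  have e2 : N + 1 - k = N - k + 1 := by omega
  simp only [e1, e2] at h
  exact h.symm

/-- Joining an orbit segment of length `m` gives `y` whose first `m` images all stay below `D y`.
The joins of `y, F y, …` then form a chain in `[y, D y]`, and where it stalls the join is mapped
below itself. -/
theorem exists_apply_le_self (hD : IsBoundedShift D N) (hc : Commute F D) {m : ℕ} (hm : N < m)
    {x : L} (hx : (F ^ m) x ≤ D x) : ∃ z, F z ≤ z := by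
  set y := partialSups (fun i => (F ^ i) x) (m - 1) with hy
  have hFy : ∀ l < m, (F ^ l) x ≤ y := fun l hl =>
    le_partialSups_of_le (fun i => (F ^ i) x) (by omega)
  have hj : ∀ j ≤ m, (F ^ j) y ≤ D y := by
    intro j hj
    rw [← OrderIso.le_symm_apply]
    refine partialSups_le _ _ _ fun i hi => ?_
    rw [OrderIso.le_symm_apply, ← RelIso.mul_apply, ← pow_add]
    -- Either the exponent is still in the segment, or `F ^ m` is traded for one `D`, leaving a
    -- remainder below `m`.
    by_cases hij : j + i < m
    · exact (hFy _ hij).trans (hD.lt_apply y).le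
    · obtain ⟨l, hl⟩ := Nat.exists_eq_add_of_le (not_lt.mp hij)
      rw [hl, add_comm, pow_add, RelIso.mul_apply]
      calc (F ^ l) ((F ^ m) x) ≤ (F ^ l) (D x) := (F ^ l).monotone hx
        _ = D ((F ^ l) x) := commute_apply (hc.pow_left l) x
        _ ≤ D y := D.monotone (hFy l (by omega))
  obtain ⟨k, hk, h⟩ := hD.exists_eq_succ_of_monotone y
    (z := partialSups (fun j => (F ^ j) y)) (partialSups _).monotone
    (by simp)
    (partialSups_le _ _ _ fun j hjN => hj j (by omega))
  refine ⟨partialSups (fun j => (F ^ j) y) k, ?_⟩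
  rw [← OrderIso.le_symm_apply]
  refine partialSups_le _ _ _ fun i hi => ?_
  rw [OrderIso.le_symm_apply, ← RelIso.mul_apply, ← pow_succ', ← h]
  exact le_partialSups_of_le (fun j => (F ^ j) y) (by omega)

/-- The joins `x ⊔ F ^ k (D x)` descend inside `[x, D x]`, each determined by the previous one
because `F x ≤ x`. So the first stall, at some `k ≤ N`, is permanent, and the hypothesis on `m`
identifies the limit as `x`. -/
theorem pow_apply_shift_le (hD : IsBoundedShift D N) (hc : Commute F D) {x : L} (hx : F x ≤ x)
    {m : ℕ} (hm : (F ^ m) (D x) ≤ x) : (F ^ N) (D x) ≤ x := by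
  set z : ℕ → L := fun k => x ⊔ (F ^ k) (D x) with hz
  have hrec : ∀ k, z (k + 1) = x ⊔ F (z k) := by
    intro k
    simp only [hz, map_sup, pow_succ', RelIso.mul_apply, ← sup_assoc, sup_eq_left.mpr hx]
  have hanti : Antitone z := antitone_nat_of_succ_le fun k => by
    simp only [hz, pow_succ, RelIso.mul_apply]
    refine sup_le_sup_left ((F ^ k).monotone ?_) x
    rw [commute_apply hc]
    exact D.monotone hx
  obtain ⟨k, hk, h⟩ := hD.exists_eq_succ_of_antitone x hanti
    (by simp [hz, (hD.lt_apply x).le]) le_sup_left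
  have hconst : ∀ j, z (k + j) = z k := by
    intro j
    induction j with
    | zero => rfl
    | succ j ih => rw [← add_assoc, hrec, ih, ← hrec, h]
  have hm' : z (k + m) ≤ x := (hanti (Nat.le_add_left m k)).trans (sup_le le_rfl hm)
  rw [hconst] at hm'
  exact le_sup_right.trans ((hanti hk).trans hm')

/-- A uniform downward drift at one point transfers to any other: cofinality sandwiches the points
within finitely many shifts `a + b`, and one more iterate gains the final `D⁻¹`. -/
theorem exists_pow_apply_le (hD : IsBoundedShift D N) (hc : Commute F D) {u : L}
    (hu : F u ≤ D⁻¹ u) (x : L) : ∃ j, (F ^ j) x ≤ D⁻¹ x := by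
  obtain ⟨a, ha⟩ := hD.cofinal u x
  obtain ⟨b, hb⟩ := hD.cofinal x u
  refine ⟨a + b + 1, ?_⟩
  have hpow := pow_apply_le_pow_apply hc.inv_right hu (a + b + 1)
  calc (F ^ (a + b + 1)) x ≤ (F ^ (a + b + 1)) ((D ^ a) u) := (F ^ (a + b + 1)).monotone ha
    _ = (D ^ a) ((F ^ (a + b + 1)) u) := commute_apply (hc.pow_pow _ _) u
    _ ≤ (D ^ a) ((D⁻¹ ^ (a + b + 1)) u) := (D ^ a).monotone hpow
    _ ≤ (D ^ a) ((D⁻¹ ^ (a + b + 1)) ((D ^ b) x)) :=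
        (D ^ a).monotone ((D⁻¹ ^ (a + b + 1)).monotone hb)
    _ = D⁻¹ x := by
        rw [← RelIso.mul_apply, ← RelIso.mul_apply]
        congr 1
        group

variable (F D) in
/-- Some point is moved by `F ^ n` no higher than by `D ^ r`. -/
def SlopeBound (n : ℕ) (r : ℤ) : Prop := ∃ x, (F ^ n) x ≤ (D ^ r) x

theorem slopeBound_mono (hD : IsBoundedShift D N) {n : ℕ} {r s : ℤ} (h : SlopeBound D F n r)
    (hrs : r ≤ s) : SlopeBound D F n s := by
  obtain ⟨x, hx⟩ := h
  exact ⟨x, hx.trans (hD.zpow_apply_mono x hrs)⟩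

theorem slopeBound_mul (hc : Commute F D) {n : ℕ} {r : ℤ} (h : SlopeBound D F n r)
    (k : ℕ) : SlopeBound D F (n * k) (r * k) := by
  obtain ⟨x, hx⟩ := h
  refine ⟨x, ?_⟩
  rw [pow_mul, zpow_mul, zpow_natCast]
  exact pow_apply_le_pow_apply ((hc.pow_left n).zpow_right r) hx k

/-- The automorphism `F ^ n * D ^ (-r)` also commutes with `D`; passing to it reduces comparison
with slope `r / n` to comparison with slope `0`. -/
theorem reduced_pow (hc : Commute F D) (n : ℕ) (r : ℤ) (m : ℕ) :
    (F ^ n * D ^ (-r)) ^ m = D ^ (-(r * m)) * F ^ (n * m) := by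
  rw [((hc.pow_left n).zpow_right (-r)).mul_pow, ← pow_mul, ← zpow_natCast (D ^ (-r)), ← zpow_mul,
    neg_mul]
  exact (hc.pow_left _).zpow_right _

theorem reduced_pow_apply_le_iff (hc : Commute F D) (n : ℕ) (r : ℤ) (m : ℕ) (s : ℤ) (x : L) :
    ((F ^ n * D ^ (-r)) ^ m) x ≤ (D ^ s) x ↔ (F ^ (n * m)) x ≤ (D ^ (r * m + s)) x := by
  rw [reduced_pow hc, RelIso.mul_apply, ← (D ^ (r * m)).le_iff_le, ← RelIso.mul_apply,
    ← RelIso.mul_apply, ← RelIso.mul_apply, ← zpow_add, ← zpow_add, add_neg_cancel, zpow_zero, one_mul]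

theorem reduced_commute (hc : Commute F D) (n : ℕ) (r : ℤ) : Commute (F ^ n * D ^ (-r)) D :=
  (hc.pow_left n).mul_left ((Commute.refl D).zpow_left _)

theorem reduced_apply_le_iff (hc : Commute F D) (n : ℕ) (r : ℤ) (x : L) :
    (F ^ n * D ^ (-r)) x ≤ x ↔ (F ^ n) x ≤ (D ^ r) x := by
  simpa using reduced_pow_apply_le_iff hc n r 1 0 x

theorem slopeBound_of_mul_add_one (hD : IsBoundedShift D N) (hc : Commute F D) {n m : ℕ} {r : ℤ}
    (hm : N < m) (h : SlopeBound D F (n * m) (r * m + 1)) : SlopeBound D F n r := by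
  obtain ⟨x, hx⟩ := h
  rw [← reduced_pow_apply_le_iff hc, zpow_one] at hx
  obtain ⟨z, hz⟩ := hD.exists_apply_le_self (reduced_commute hc n r) hm hx
  exact ⟨z, (reduced_apply_le_iff hc n r z).mp hz⟩

theorem slopeBound_of_mul (hD : IsBoundedShift D N) (hc : Commute F D) {n m : ℕ} {r : ℤ}
    (hm : 0 < m) (h : SlopeBound D F (n * m) (r * m)) : SlopeBound D F n r := by
  refine hD.slopeBound_of_mul_add_one hc (m := m * (N + 1)) (by nlinarith) ?_
  have := slopeBound_mul hc h (N + 1)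
  rw [mul_assoc] at this
  refine hD.slopeBound_mono this ?_
  push_cast
  linarith

/-- The reduced automorphism fixes or lowers `x`, while the smaller slope `s / m` makes it drift
down at some `u`, hence eventually at `x`. By `pow_apply_shift_le`, `N` iterates already gain a full
shift. -/
theorem slopeBound_improve (hD : IsBoundedShift D N) (hc : Commute F D) {n m : ℕ} {r s : ℤ}
    (h : SlopeBound D F n r) (h' : SlopeBound D F m s) (hlt : s * n < r * m) :
    SlopeBound D F (n * N) (r * N - 1) := by
  obtain ⟨x, hx⟩ := h
  obtain ⟨u, hu⟩ := hD.slopeBound_mono (slopeBound_mul hc h' n)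
    (show s * n ≤ r * m + (-1) by linarith)
  rw [mul_comm m n, ← reduced_pow_apply_le_iff hc, zpow_neg_one] at hu
  rw [← reduced_apply_le_iff hc] at hx
  have hc' := reduced_commute hc n r
  obtain ⟨j, hj⟩ := hD.exists_pow_apply_le (hc'.pow_left m) hu x
  have hj' : ((F ^ n * D ^ (-r)) ^ (m * j)) (D x) ≤ x := by
    rw [commute_apply (hc'.pow_left _), pow_mul]
    calc _ ≤ D (D⁻¹ x) := D.monotone hj
      _ = x := RelIso.apply_inv_self D x
  have key := hD.pow_apply_shift_le hc' hx hj'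
  refine ⟨x, ?_⟩
  rw [sub_eq_add_neg, ← reduced_pow_apply_le_iff hc, zpow_neg_one, ← D.le_iff_le,
    ← commute_apply (hc'.pow_left _)]
  exact key.trans_eq (RelIso.apply_inv_self D x).symm

/-- With `D ^ b * F` raising `x₀`, a slope below `-b` would make a power of it drift down
everywhere, including at `x₀`. -/
theorem exists_lower_slope [Nonempty L] (hD : IsBoundedShift D N) (hc : Commute F D) :
    ∃ b : ℕ, ∀ (n : ℕ) (r : ℤ), SlopeBound D F n r → -(b * n : ℤ) ≤ r := by
  obtain ⟨x₀⟩ := ‹Nonempty L›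
  obtain ⟨b, hb⟩ := hD.cofinal (F x₀) x₀
  refine ⟨b, fun n r ⟨x, hx⟩ => ?_⟩
  by_contra! hr
  have hcb : Commute F (D ^ b) := hc.pow_right b
  set H := (D ^ b * F) ^ n with hH
  have hcH : Commute H D := (((Commute.refl D).pow_left b).mul_left hc).pow_left n
  have hHx : H x ≤ D⁻¹ x := by
    rw [hH, hcb.symm.mul_pow, RelIso.mul_apply]
    calc _ ≤ ((D ^ b) ^ n) ((D ^ r) x) := ((D ^ b) ^ n).monotone hx
      _ = (D ^ (b * n + r : ℤ)) x := by
        rw [zpow_add, RelIso.mul_apply, zpow_mul, zpow_natCast, zpow_natCast]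
      _ ≤ (D ^ (-1 : ℤ)) x := hD.zpow_apply_mono x (by linarith)
      _ = D⁻¹ x := by rw [zpow_neg_one]
  obtain ⟨j, hj⟩ := hD.exists_pow_apply_le hcH hHx x₀
  have h1 : x₀ ≤ (H ^ j) x₀ := by
    have := pow_apply_le_pow_apply (F := 1) (Commute.one_left (D ^ b * F)) (x := x₀)
      (by simpa using hb) (n * j)
    rw [pow_mul (D ^ b * F)] at this
    simpa using this
  have h2 : D⁻¹ x₀ < x₀ := by
    have := hD.lt_apply (D⁻¹ x₀)
    rwa [RelIso.apply_inv_self] at this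
  exact absurd (h1.trans hj) (not_le_of_gt h2)

end IsBoundedShift

/-- A real number whose multiples never lie strictly within `1 / N` below an integer is rational
with denominator at most `N`. -/
theorem exists_mul_eq_int_of_gap {N : ℕ} (hN : 0 < N) (τ : ℝ)
    (h : ∀ n : ℕ, 0 < n → ∀ r : ℤ, n * τ < r → n * τ + 1 / N ≤ r) :
    ∃ q : ℕ, 0 < q ∧ q ≤ N ∧ ∃ p : ℤ, q * τ = p := by
  obtain ⟨q, hq0, hqN, hq⟩ := Real.exists_nat_abs_mul_sub_round_le τ hN
  refine ⟨q, hq0, hqN, round (q * τ), ?_⟩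
  set p : ℤ := round (q * τ)
  have hN' : (0 : ℝ) < N := by exact_mod_cast hN
  have hlt : 1 / ((N : ℝ) + 1) < 1 / N := one_div_lt_one_div_of_lt hN' (by linarith)
  obtain ⟨hl, hr⟩ := abs_le.mp hq
  by_contra hne
  rcases lt_or_gt_of_ne hne with hcase | hcase
  · linarith [h q hq0 p hcase]
  -- Overshooting is excluded by taking multiples: for the last `m` with `m * ε < 1`, the number `q
  -- * m * τ` lies below the integer `m * p + 1` by at most `ε ≤ 1 / (N + 1)`, against the gap.
  · set ε : ℝ := q * τ - p with hε
    have hε0 : 0 < ε := by linarith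
    have hε2 : ε ≤ 1 / 2 := hr.trans (one_div_le_one_div_of_le two_pos (by
      have : (1 : ℝ) ≤ N := by exact_mod_cast hN
      linarith))
    set c := ⌈1 / ε⌉₊ with hc
    have hc1 : 1 / ε ≤ c := Nat.le_ceil _
    have hc2 : (c : ℝ) < 1 / ε + 1 := Nat.ceil_lt_add_one (by positivity)
    have h2 : 2 ≤ 1 / ε := by rw [le_div_iff₀ hε0]; linarith
    have hc3 : 2 ≤ c := by exact_mod_cast h2.trans hc1
    obtain ⟨m, hm⟩ := Nat.exists_eq_add_of_le' (show 1 ≤ c by omega)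
    have hm0 : 0 < m := by omega
    rw [hm] at hc1 hc2
    push_cast at hc1 hc2
    have e1 : (m : ℝ) * ε < 1 := by
      have : (m : ℝ) < 1 / ε := by linarith
      rwa [lt_div_iff₀ hε0] at this
    have e2 : 1 ≤ (m + 1 : ℝ) * ε := by rwa [div_le_iff₀ hε0] at hc1
    have key := h (q * m) (Nat.mul_pos hq0 hm0) (m * p + 1) (by push_cast; nlinarith)
    push_cast at key
    nlinarith

/-! ### Existence and rationality of the slope -/

namespace IsBoundedShift

variable {D F : L ≃o L} {N : ℕ}

theorem exists_slope [Nonempty L] (hD : IsBoundedShift D N) (hc : Commute F D) :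
    ∃ τ : ℝ, (∀ n : ℕ, 0 < n → ∀ r : ℤ, SlopeBound D F n r ↔ n * τ ≤ r) ∧
      ∃ q : ℕ, 0 < q ∧ q ≤ N ∧ ∃ p : ℤ, q * τ = p := by
  set T : Set ℝ := {t | ∃ (n : ℕ) (r : ℤ), 0 < n ∧ SlopeBound D F n r ∧ t = r / n} with hT
  have x₀ := Classical.arbitrary L
  have hne : T.Nonempty := by
    obtain ⟨b, hb⟩ := hD.cofinal x₀ (F x₀)
    exact ⟨_, 1, b, one_pos, ⟨x₀, by simpa using hb⟩, rfl⟩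
  have hbdd : BddBelow T := by
    obtain ⟨b, hb⟩ := hD.exists_lower_slope hc
    refine ⟨-b, ?_⟩
    rintro _ ⟨n, r, hn, h, rfl⟩
    have hn' : (0 : ℝ) < n := by exact_mod_cast hn
    rw [le_div_iff₀ hn']
    have : (-(b * n : ℤ) : ℝ) ≤ r := by exact_mod_cast hb n r h
    push_cast at this
    linarith
  have hex : ∀ (n : ℕ) (r : ℤ), 0 < n → n * sInf T < r →
      ∃ (m : ℕ) (s : ℤ), 0 < m ∧ SlopeBound D F m s ∧ s * n < r * m := by
    intro n r hn h
    have hn' : (0 : ℝ) < n := by exact_mod_cast hn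
    rw [← lt_div_iff₀' hn'] at h
    obtain ⟨_, ⟨m, s, hm, hS, rfl⟩, hlt⟩ := exists_lt_of_csInf_lt hne h
    have hm' : (0 : ℝ) < m := by exact_mod_cast hm
    rw [div_lt_div_iff₀ hm' hn'] at hlt
    exact ⟨m, s, hm, hS, by exact_mod_cast hlt⟩
  have hiff : ∀ n : ℕ, 0 < n → ∀ r : ℤ, SlopeBound D F n r ↔ n * sInf T ≤ r := by
    intro n hn r
    have hn' : (0 : ℝ) < n := by exact_mod_cast hn
    constructor
    · intro h
      rw [← le_div_iff₀' hn']
      exact csInf_le hbdd ⟨n, r, hn, h, rfl⟩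
    · intro h
      -- The infimum need not be approached strictly below `r / n`; the spare `+ 1` after scaling by
      -- `N + 1` makes the inequality strict.
      refine hD.slopeBound_of_mul_add_one hc (Nat.lt_succ_self N) ?_
      obtain ⟨m, s, hm, hS, hlt⟩ := hex (n * (N + 1)) (r * (N + 1 : ℕ) + 1) (by positivity) (by
        push_cast
        nlinarith [(N.cast_nonneg : (0 : ℝ) ≤ N)])
      refine hD.slopeBound_of_mul hc hm ?_
      rw [mul_comm _ m]
      exact hD.slopeBound_mono (slopeBound_mul hc hS _) hlt.le
  have hN : 0 < N := hD.height x₀ 1 (fun i => (D ^ i) x₀)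
    (fun i hi => by
      obtain rfl : i = 0 := by omega
      simpa using hD.lt_apply x₀) (by simp) (by simp)
  have hN' : (0 : ℝ) < N := by exact_mod_cast hN
  refine ⟨sInf T, hiff, exists_mul_eq_int_of_gap hN _ fun n hn r hlt => ?_⟩
  obtain ⟨m, s, hm, hS, hsr⟩ := hex n r hn hlt
  have := hD.slopeBound_improve hc ((hiff n hn r).mpr hlt.le) hS hsr
  rw [hiff _ (Nat.mul_pos hn hN)] at this
  push_cast at this
  rw [← le_sub_iff_add_le, ← mul_le_mul_iff_left₀ hN', sub_mul, one_div_mul_cancel hN'.ne']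
  linarith

end IsBoundedShift

end Lattice
-- Garside elements and atomic monoids
section Monoid

variable {M : Type*} [Monoid M]

theorem LeL.mul_self_mem {a Δ : M} (hΔ : IsGarsideElement Δ) (h : LeL a Δ) :
    (∃ b, a * Δ = Δ * b) ∧ ∃ b, Δ * a = b * Δ := by
  constructor
  · obtain ⟨b, hb⟩ := h
    obtain ⟨c, hc⟩ := (hΔ.left_iff_right b).mpr ⟨a, hb⟩
    exact ⟨c, by rw [← hb, mul_assoc a b c, hc, hb]⟩
  · obtain ⟨b, hb⟩ := (hΔ.left_iff_right a).mp h
    obtain ⟨c, hc⟩ := (hΔ.left_iff_right b).mp ⟨a, hb⟩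
    exact ⟨c, by rw [← hb, ← mul_assoc, hb, hc]⟩

/-- Simple elements can be moved past `Δ` and they generate. This is what makes right multiplication
by `Δ` preserve and reflect left divisibility. -/
theorem IsGarsideElement.exists_conj {Δ : M} (hΔ : IsGarsideElement Δ) (a : M) :
    (∃ b, a * Δ = Δ * b) ∧ ∃ b, Δ * a = b * Δ := by
  have ha : a ∈ Submonoid.closure {a : M | LeL a Δ} := hΔ.generates ▸ Submonoid.mem_top a
  induction ha using Submonoid.closure_induction with
  | mem x hx => exact LeL.mul_self_mem hΔ hx
  | one => exact ⟨⟨1, by simp⟩, ⟨1, by simp⟩⟩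
  | mul x y _ _ hx hy =>
    obtain ⟨⟨b, hb⟩, ⟨b', hb'⟩⟩ := hx
    obtain ⟨⟨c, hc⟩, ⟨c', hc'⟩⟩ := hy
    exact ⟨⟨b * c, by rw [mul_assoc, hc, ← mul_assoc, hb, mul_assoc]⟩,
      ⟨b' * c', by rw [← mul_assoc, hb', mul_assoc, hc', mul_assoc]⟩⟩

theorem length_le_norm {l : List M} (hl : ∀ x ∈ l, IsAtomElt x) :
    (l.length : ℕ∞) ≤ norm l.prod :=
  le_iSup₂_of_le l ⟨hl, rfl⟩ le_rfl

namespace IsAtomicMonoid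

theorem exists_list (h : IsAtomicMonoid M) (a : M) :
    ∃ l : List M, (∀ x ∈ l, IsAtomElt x) ∧ l.prod = a :=
  Submonoid.exists_list_of_mem_closure (h.generated ▸ Submonoid.mem_top a)

/-- A nonempty atomic expression of `1` could be repeated to exceed the finite norm of `1`. -/
theorem eq_one_of_mul_eq_one (h : IsAtomicMonoid M) {a b : M} (hab : a * b = 1) : a = 1 := by
  obtain ⟨l, hl, rfl⟩ := h.exists_list a
  obtain ⟨l', hl', rfl⟩ := h.exists_list b
  obtain ⟨K, hK⟩ := ENat.ne_top_iff_exists.mp (h.norm_lt_top 1).ne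
  set w := (List.replicate (K + 1) (l ++ l')).flatten with hw
  have hprod : w.prod = 1 := by
    simp [hw, List.prod_flatten, hab]
  have hlen := length_le_norm (l := w) (by
    intro x hx
    simp only [hw, List.mem_flatten, List.mem_replicate] at hx
    obtain ⟨_, ⟨-, rfl⟩, hx⟩ := hx
    rcases List.mem_append.mp hx with hx | hx
    exacts [hl x hx, hl' x hx])
  rw [hprod, ← hK, Nat.cast_le] at hlen
  have : w.length = (K + 1) * (l.length + l'.length) := by
    simp [hw, List.length_flatten]
  have h0 : l.length = 0 := by nlinarith
  rw [List.length_eq_zero_iff.mp h0, List.prod_nil]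

end IsAtomicMonoid

end Monoid

/-! ### Left divisibility on the group of fractions -/

section Group

variable {M G : Type*} [Monoid M] [Group G] {φ : M →* G} {Δ : M}

theorem gLeL_iff {g h : G} : GLeL φ g h ↔ g⁻¹ * h ∈ MonoidHom.mrange φ := by
  constructor
  · rintro ⟨c, rfl⟩
    exact ⟨c, by group⟩
  · rintro ⟨c, hc⟩
    exact ⟨c, by rw [hc]; group⟩

theorem gLeL_mul_left_iff {k g h : G} : GLeL φ (k * g) (k * h) ↔ GLeL φ g h := by
  rw [gLeL_iff, gLeL_iff]
  congr! 1
  group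

theorem gLeL_refl (g : G) : GLeL φ g g := ⟨1, by simp⟩

theorem GLeL.trans {a b c : G} (h : GLeL φ a b) (h' : GLeL φ b c) : GLeL φ a c := by
  obtain ⟨x, rfl⟩ := h
  obtain ⟨y, rfl⟩ := h'
  exact ⟨x * y, by simp [mul_assoc]⟩

theorem gLeL_mul_right_iff (hΔ : IsGarsideElement Δ) {g h : G} :
    GLeL φ (g * φ Δ) (h * φ Δ) ↔ GLeL φ g h := by
  constructor
  · rintro ⟨c, hc⟩
    obtain ⟨b, hb⟩ := (hΔ.exists_conj c).2
    refine ⟨b, mul_right_cancel (b := φ Δ) ?_⟩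
    rw [← hc, mul_assoc, ← map_mul, ← hb, map_mul, mul_assoc]
  · rintro ⟨c, rfl⟩
    obtain ⟨b, hb⟩ := (hΔ.exists_conj c).1
    exact ⟨b, by rw [mul_assoc, ← map_mul, ← hb, map_mul, mul_assoc]⟩

theorem gLeL_mul_right_zpow_iff (hΔ : IsGarsideElement Δ) {g h : G} (r : ℤ) :
    GLeL φ (g * φ Δ ^ r) (h * φ Δ ^ r) ↔ GLeL φ g h := by
  induction r with
  | zero => simp
  | succ n ih => rw [zpow_add_one, ← mul_assoc, ← mul_assoc, gLeL_mul_right_iff hΔ, ih]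
  | pred n ih =>
    rw [← ih, ← gLeL_mul_right_iff hΔ (g := g * _), mul_assoc, mul_assoc, ← zpow_add_one,
      sub_add_cancel]

theorem zpow_gLeL_zpow {r s : ℤ} (h : r ≤ s) : GLeL φ (φ Δ ^ r) (φ Δ ^ s) := by
  obtain ⟨k, rfl⟩ := Int.le.dest h
  exact ⟨Δ ^ k, by rw [map_pow, zpow_add, zpow_natCast]⟩

theorem gLeL_zpow_neg_iff (hΔ : IsGarsideElement Δ) {g : G} {r : ℤ} :
    GLeL φ (φ Δ ^ (-r)) g ↔ GLeL φ g⁻¹ (φ Δ ^ r) := by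
  rw [← gLeL_mul_right_zpow_iff hΔ r, ← gLeL_mul_left_iff (k := g⁻¹)]
  simp

theorem GLeL.mul_zpow (hΔ : IsGarsideElement Δ) {g h : G} {r s : ℤ}
    (hg : GLeL φ g (φ Δ ^ r)) (hh : GLeL φ h (φ Δ ^ s)) : GLeL φ (g * h) (φ Δ ^ (r + s)) := by
  rw [zpow_add]
  exact (gLeL_mul_left_iff.mpr hh).trans ((gLeL_mul_right_zpow_iff hΔ s).mpr hg)

theorem exists_map_gLeL_pow (hΔ : IsGarsideElement Δ) (a : M) :
    ∃ e : ℕ, GLeL φ (φ a) (φ Δ ^ (e : ℤ)) := by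
  have ha : a ∈ Submonoid.closure {a : M | LeL a Δ} := hΔ.generates ▸ Submonoid.mem_top a
  induction ha using Submonoid.closure_induction with
  | mem x hx =>
    obtain ⟨c, hc⟩ := hx
    exact ⟨1, c, by simp [← hc]⟩
  | one => exact ⟨0, 1, by simp⟩
  | mul x y _ _ hx hy =>
    obtain ⟨e, he⟩ := hx
    obtain ⟨f, hf⟩ := hy
    exact ⟨e + f, by simpa using GLeL.mul_zpow hΔ he hf⟩

theorem IsGroupOfFractions.exists_gLeL_pow (hφ : IsGroupOfFractions φ) (hΔ : IsGarsideElement Δ)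
    (g : G) : ∃ e : ℕ, GLeL φ g (φ Δ ^ (e : ℤ)) := by
  obtain ⟨a, b, rfl⟩ := hφ.fraction g
  obtain ⟨e, he⟩ := exists_map_gLeL_pow (φ := φ) hΔ a
  exact ⟨e, GLeL.trans ⟨b, by simp⟩ he⟩

theorem IsGarsideMonoid.gLeL_antisymm (hM : IsGarsideMonoid M) (hφ : IsGroupOfFractions φ)
    {a b : G} (h : GLeL φ a b) (h' : GLeL φ b a) : a = b := by
  obtain ⟨c, rfl⟩ := h
  obtain ⟨d, hd⟩ := h'
  rw [mul_assoc, mul_eq_left, ← map_mul, map_eq_one_iff φ hφ.injective] at hd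
  rw [hM.atomic.eq_one_of_mul_eq_one hd, map_one, mul_one]

/-- A sufficiently negative power of `Δ` lies below both elements, so the join is a translate of one
in `M`. -/
theorem IsGarsideMonoid.exists_gLeL_join (hM : IsGarsideMonoid M) (hφ : IsGroupOfFractions φ)
    (hΔ : IsGarsideElement Δ) (a b : G) :
    ∃ m, GLeL φ a m ∧ GLeL φ b m ∧ ∀ c, GLeL φ a c → GLeL φ b c → GLeL φ m c := by
  obtain ⟨e, he⟩ := hφ.exists_gLeL_pow hΔ a⁻¹
  obtain ⟨f, hf⟩ := hφ.exists_gLeL_pow hΔ b⁻¹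
  rw [← gLeL_zpow_neg_iff hΔ] at he hf
  set w := φ Δ ^ (-(max e f : ℤ)) with hw
  have hwa : GLeL φ w a := (zpow_gLeL_zpow (neg_le_neg (le_max_left _ _))).trans he
  have hwb : GLeL φ w b := (zpow_gLeL_zpow (neg_le_neg (le_max_right _ _))).trans hf
  obtain ⟨a', rfl⟩ := hwa
  obtain ⟨b', rfl⟩ := hwb
  obtain ⟨m, ⟨x, hx⟩, ⟨y, hy⟩, hm⟩ := hM.lattice_left.2 a' b'
  refine ⟨w * φ m, gLeL_mul_left_iff.mpr ⟨x, by rw [← hx, map_mul]⟩,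
    gLeL_mul_left_iff.mpr ⟨y, by rw [← hy, map_mul]⟩, ?_⟩
  rintro _ ⟨c, rfl⟩ ⟨d, hd⟩
  rw [mul_assoc, mul_assoc, mul_right_inj, ← map_mul, ← map_mul] at hd
  obtain ⟨z, hz⟩ := hm (a' * c) ⟨c, rfl⟩ ⟨d, hφ.injective hd⟩
  exact ⟨z, by rw [mul_assoc, mul_assoc, ← map_mul, ← map_mul, hz]⟩

/-- The semilattice structure given by left divisibility on the group of fractions. -/
@[reducible]
noncomputable def fractionSemilattice (hM : IsGarsideMonoid M) (hφ : IsGroupOfFractions φ)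
    (hΔ : IsGarsideElement Δ) : SemilatticeSup G where
  le := GLeL φ
  le_refl := gLeL_refl
  le_trans _ _ _ := GLeL.trans
  le_antisymm _ _ := hM.gLeL_antisymm hφ
  sup a b := (hM.exists_gLeL_join hφ hΔ a b).choose
  le_sup_left a b := (hM.exists_gLeL_join hφ hΔ a b).choose_spec.1
  le_sup_right a b := (hM.exists_gLeL_join hφ hΔ a b).choose_spec.2.1
  sup_le a b := (hM.exists_gLeL_join hφ hΔ a b).choose_spec.2.2

theorem map_garside_ne_one [Nontrivial G] (hM : IsGarsideMonoid M) (hφ : IsGroupOfFractions φ)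
    (hΔ : IsGarsideElement Δ) : Δ ≠ 1 := by
  rintro rfl
  have hone : ∀ g : G, GLeL φ g 1 := fun g => by
    simpa using (hφ.exists_gLeL_pow hΔ g).choose_spec
  obtain ⟨g, hg⟩ := exists_ne (1 : G)
  refine hg (hM.gLeL_antisymm hφ (hone g) ?_)
  have := (gLeL_mul_left_iff (φ := φ) (k := g)).mpr (hone g⁻¹)
  simpa using this

theorem zpow_gLeL_zpow_iff [Nontrivial G] (hM : IsGarsideMonoid M) (hφ : IsGroupOfFractions φ)
    (hΔ : IsGarsideElement Δ) {r s : ℤ} : GLeL φ (φ Δ ^ r) (φ Δ ^ s) ↔ r ≤ s := by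
  refine ⟨fun h => ?_, zpow_gLeL_zpow⟩
  by_contra! hlt
  have h1 : GLeL φ (φ Δ ^ (s + 1)) (φ Δ ^ s) := (zpow_gLeL_zpow hlt).trans h
  have h2 := hM.gLeL_antisymm hφ h1 (zpow_gLeL_zpow (by omega))
  rw [zpow_add_one, mul_eq_left, map_eq_one_iff φ hφ.injective] at h2
  exact map_garside_ne_one hM hφ hΔ h2

theorem sup_le_iff_gLeL [Nontrivial G] (hM : IsGarsideMonoid M) (hφ : IsGroupOfFractions φ)
    (hΔ : IsGarsideElement Δ) {g : G} {s : ℤ} : sup φ Δ g ≤ s ↔ GLeL φ g (φ Δ ^ s) := by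
  have hbdd : BddBelow {s : ℤ | GLeL φ g (φ Δ ^ s)} := by
    obtain ⟨e, he⟩ := hφ.exists_gLeL_pow hΔ g⁻¹
    rw [← gLeL_zpow_neg_iff hΔ] at he
    exact ⟨-e, fun s hs => (zpow_gLeL_zpow_iff hM hφ hΔ).mp (he.trans hs)⟩
  obtain ⟨e, he⟩ := hφ.exists_gLeL_pow hΔ g
  have hmem : GLeL φ g (φ Δ ^ (sup φ Δ g)) := Int.csInf_mem ⟨(e : ℤ), he⟩ hbdd
  exact ⟨fun h => hmem.trans (zpow_gLeL_zpow h), fun h => csInf_le hbdd h⟩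

theorem inf_eq_neg_sup_inv [Nontrivial G] (hM : IsGarsideMonoid M) (hφ : IsGroupOfFractions φ)
    (hΔ : IsGarsideElement Δ) (g : G) : inf φ Δ g = -sup φ Δ g⁻¹ := by
  have key : ∀ r : ℤ, GLeL φ (φ Δ ^ r) g ↔ r ≤ -sup φ Δ g⁻¹ := fun r => by
    rw [le_neg, sup_le_iff_gLeL hM hφ hΔ, ← gLeL_zpow_neg_iff hΔ, neg_neg]
  have : IsGreatest {r : ℤ | GLeL φ (φ Δ ^ r) g} (-sup φ Δ g⁻¹) :=
    ⟨(key _).mpr le_rfl, fun r hr => (key r).mp hr⟩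
  exact this.csSup_eq

theorem exists_atom_list_of_chain (hM : IsGarsideMonoid M) {z : ℕ → G} {k : ℕ}
    (hz : ∀ i < k, GLeL φ (z i) (z (i + 1)) ∧ z i ≠ z (i + 1)) :
    ∃ l : List M, (∀ x ∈ l, IsAtomElt x) ∧ k ≤ l.length ∧ z 0 * φ l.prod = z k := by
  induction k with
  | zero => exact ⟨[], by simp⟩
  | succ k ih =>
    obtain ⟨l, hl, hlen, hprod⟩ := ih fun i hi => hz i (by omega)
    obtain ⟨⟨c, hc⟩, hne⟩ := hz k (Nat.lt_succ_self k)
    obtain ⟨l', hl', rfl⟩ := hM.atomic.exists_list c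
    have h0 : l' ≠ [] := by
      rintro rfl
      simp at hc
      exact hne hc
    have := List.length_pos_iff.mpr h0
    refine ⟨l ++ l', fun x hx => (List.mem_append.mp hx).elim (hl x) (hl' x), ?_, ?_⟩
    · rw [List.length_append]; omega
    · rw [List.prod_append, map_mul, ← mul_assoc, hprod, hc]

theorem chain_length_le (hM : IsGarsideMonoid M) (hφ : IsGroupOfFractions φ) {N : ℕ}
    (hN : norm Δ = (N : ℕ∞)) {x : G} {z : ℕ → G} {k : ℕ}
    (hz : ∀ i < k, GLeL φ (z i) (z (i + 1)) ∧ z i ≠ z (i + 1))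
    (h0 : GLeL φ x (z 0)) (h1 : GLeL φ (z k) (x * φ Δ)) : k ≤ N := by
  obtain ⟨l, hl, hlen, hprod⟩ := exists_atom_list_of_chain hM hz
  obtain ⟨a, ha⟩ := h0
  obtain ⟨b, hb⟩ := h1
  obtain ⟨la, hla, rfl⟩ := hM.atomic.exists_list a
  obtain ⟨lb, hlb, rfl⟩ := hM.atomic.exists_list b
  have hΔ' : (la ++ l ++ lb).prod = Δ := by
    rw [← hprod, ← ha, mul_assoc, mul_assoc, mul_right_inj, ← map_mul, ← map_mul] at hb
    rw [← hφ.injective hb, List.prod_append, List.prod_append, mul_assoc]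
  have := length_le_norm (l := la ++ l ++ lb) (by
    simp only [List.mem_append]
    rintro x ((hx | hx) | hx)
    exacts [hla x hx, hl x hx, hlb x hx])
  rw [hΔ', hN, Nat.cast_le] at this
  simp only [List.length_append] at this
  omega

/-- The possible bounds on `sup` over the conjugates of `g ^ n` are governed by a single slope,
which is rational with denominator at most `‖Δ‖`. -/
theorem exists_sup_slope [Nontrivial G] (hM : IsGarsideMonoid M) (hφ : IsGroupOfFractions φ)
    (hΔ : IsGarsideElement Δ) {N : ℕ} (hN : norm Δ = (N : ℕ∞)) (g : G) :
    ∃ τ : ℝ, (∀ n : ℕ, 0 < n → ∀ r : ℤ,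
        (∃ y ∈ conjugatesOf (g ^ n), sup φ Δ y ≤ r) ↔ n * τ ≤ r) ∧
      ∃ q : ℕ, 0 < q ∧ q ≤ N ∧ ∃ p : ℤ, q * τ = p := by
  let _ := fractionSemilattice hM hφ hΔ
  let F : G ≃o G := ⟨Equiv.mulLeft g, gLeL_mul_left_iff⟩
  let D : G ≃o G := ⟨Equiv.mulRight (φ Δ), gLeL_mul_right_iff hΔ⟩
  have hF : ∀ (n : ℕ) (x : G), (F ^ n) x = g ^ n * x := by
    intro n
    induction n with
    | zero => simp
    | succ n ih =>
      intro x
      rw [pow_succ, RelIso.mul_apply, ih, pow_succ, mul_assoc]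
      rfl
  have hDn : ∀ (n : ℕ) (x : G), (D ^ n) x = x * φ Δ ^ n := by
    intro n
    induction n with
    | zero => simp
    | succ n ih =>
      intro x
      rw [pow_succ', RelIso.mul_apply, ih, pow_succ, ← mul_assoc]
      rfl
  have hD : ∀ (r : ℤ) (x : G), (D ^ r) x = x * φ Δ ^ r := by
    intro r x
    obtain ⟨n, rfl | rfl⟩ := r.eq_nat_or_neg
    · rw [zpow_natCast, zpow_natCast, hDn]
    · apply (D ^ n).injective
      rw [← RelIso.mul_apply, ← zpow_natCast, ← zpow_add, zpow_natCast, hDn]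
      simp
  have hc : Commute F D := by
    ext x
    exact (mul_assoc g x (φ Δ)).symm
  have hshift : IsBoundedShift D N := by
    refine ⟨fun x => lt_of_le_of_ne ⟨Δ, rfl⟩ fun h => ?_, fun x y => ?_, fun x k z hz h0 h1 => ?_⟩
    · refine map_garside_ne_one hM hφ hΔ ((map_eq_one_iff φ hφ.injective).mp ?_)
      exact mul_eq_left.mp (show x * φ Δ = x from h.symm)
    · obtain ⟨e, he⟩ := hφ.exists_gLeL_pow hΔ (x⁻¹ * y)
      refine ⟨e, ?_⟩
      rw [hDn]
      show GLeL φ y (x * φ Δ ^ e)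
      simpa using (gLeL_mul_left_iff (k := x)).mpr he
    · exact chain_length_le hM hφ hN (fun i hi => ⟨(hz i hi).le, (hz i hi).ne⟩) h0 h1
  obtain ⟨τ, hτ, hq⟩ := hshift.exists_slope hc
  refine ⟨τ, fun n hn r => ?_, hq⟩
  rw [← hτ n hn r]
  constructor
  · rintro ⟨y, hy, hyr⟩
    obtain ⟨c, rfl⟩ := isConj_iff.mp hy
    refine ⟨c⁻¹, ?_⟩
    rw [hF, hD]
    show GLeL φ _ _
    rw [sup_le_iff_gLeL hM hφ hΔ, ← gLeL_mul_left_iff (k := c⁻¹)] at hyr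
    convert hyr using 1
    group
  · rintro ⟨x, hx⟩
    rw [hF, hD] at hx
    replace hx : GLeL φ (g ^ n * x) (x * φ Δ ^ r) := hx
    refine ⟨x⁻¹ * g ^ n * x, isConj_iff.mpr ⟨x⁻¹, by group⟩, ?_⟩
    rw [sup_le_iff_gLeL hM hφ hΔ, ← gLeL_mul_left_iff (k := x)]
    convert hx using 1
    group

/-! ### Minimal `sup` on conjugacy classes of powers -/

theorem conjugatesOf_pow {g h : G} (hh : h ∈ conjugatesOf g) (k : ℕ) :
    h ^ k ∈ conjugatesOf (g ^ k) := by
  obtain ⟨c, rfl⟩ := isConj_iff.mp hh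
  exact isConj_iff.mpr ⟨c, by simp⟩

theorem conjugatesOf_inv {g h : G} (hh : h ∈ conjugatesOf g) : h⁻¹ ∈ conjugatesOf g⁻¹ := by
  obtain ⟨c, rfl⟩ := isConj_iff.mp hh
  exact isConj_iff.mpr ⟨c, by group⟩

theorem exists_sup_pow_eq [Nontrivial G] (hM : IsGarsideMonoid M) (hφ : IsGroupOfFractions φ)
    (hΔ : IsGarsideElement Δ) {N : ℕ} (hN : norm Δ = (N : ℕ∞)) (g : G) :
    ∃ q : ℕ, 0 < q ∧ q ≤ N ∧ ∀ n : ℕ, 0 < n → q ∣ n → ∀ h ∈ conjugatesOf (g ^ n),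
      (∀ y ∈ conjugatesOf (g ^ n), sup φ Δ h ≤ sup φ Δ y) →
      ∀ k : ℕ, sup φ Δ (h ^ k) = k * sup φ Δ h := by
  obtain ⟨τ, hτ, q, hq, hqN, p, hp⟩ := exists_sup_slope hM hφ hΔ hN g
  refine ⟨q, hq, hqN, ?_⟩
  rintro _ hn ⟨t, rfl⟩ h hh hmin k
  have hP : ((q * t : ℕ) : ℝ) * τ = (p * t : ℤ) := by
    push_cast
    rw [mul_right_comm, hp]
  have hsup : sup φ Δ h = p * t := by
    apply le_antisymm
    · obtain ⟨y, hy, hyr⟩ := (hτ _ hn (p * t)).mpr hP.le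
      exact (hmin y hy).trans hyr
    · have := (hτ _ hn _).mp ⟨h, hh, le_rfl⟩
      rw [hP] at this
      exact_mod_cast this
  apply le_antisymm
  · rw [sup_le_iff_gLeL hM hφ hΔ]
    induction k with
    | zero => simpa using gLeL_refl (φ := φ) (1 : G)
    | succ k ih =>
      rw [pow_succ, Nat.cast_succ, add_one_mul]
      exact ih.mul_zpow hΔ ((sup_le_iff_gLeL hM hφ hΔ).mp le_rfl)
  · rcases Nat.eq_zero_or_pos k with rfl | hk
    · have := (sup_le_iff_gLeL hM hφ hΔ (g := h ^ 0)).mp le_rfl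
      rw [pow_zero, ← zpow_zero (φ Δ), zpow_gLeL_zpow_iff hM hφ hΔ] at this
      simpa using this
    · have := (hτ (q * t * k) (Nat.mul_pos hn hk) _).mp
        ⟨h ^ k, by rw [pow_mul]; exact conjugatesOf_pow hh k, le_rfl⟩
      rw [Nat.cast_mul, mul_right_comm, hP] at this
      rw [hsup, mul_comm]
      exact_mod_cast this

/-! ### Word length in the simple elements -/

theorem exists_simple_list (hM : IsGarsideMonoid M) (hφ : IsGroupOfFractions φ)
    (hΔ : IsGarsideElement Δ) (s : ℕ) {g : G} (h0 : GLeL φ 1 g) (hs : GLeL φ g (φ Δ ^ (s : ℤ))) :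
    ∃ l : List G, (∀ x ∈ l, x ∈ simpleElements φ Δ) ∧ l.prod = g ∧ l.length = s := by
  induction s generalizing g with
  | zero => exact ⟨[], by simp [hM.gLeL_antisymm hφ h0 (by simpa using hs)]⟩
  | succ s ih =>
    -- The join `u` of `g * Δ⁻¹` and `1` lies in `[1, Δ ^ s]`, and the last factor `u⁻¹ * g` is
    -- simple.
    obtain ⟨u, hgu, ⟨b, hb⟩, hu⟩ := hM.exists_gLeL_join hφ hΔ (g * φ Δ ^ (-1 : ℤ)) 1
    rw [one_mul] at hb
    obtain ⟨d, hd⟩ := hu g ⟨Δ, by simp⟩ h0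
    obtain ⟨l, hl, hprod, hlen⟩ := ih (g := u) ⟨b, by simpa using hb⟩ (hu _ (by
      rw [← gLeL_mul_right_zpow_iff hΔ 1, mul_assoc, ← zpow_add, ← zpow_add]
      simpa using hs) (by simpa using zpow_gLeL_zpow (φ := φ) (Δ := Δ) (Nat.cast_nonneg s)))
    refine ⟨l ++ [φ d], ?_, by simp [hprod, hd], by simp [hlen]⟩
    have hdΔ : GLeL φ (φ d) (φ Δ) := by
      rw [← gLeL_mul_left_iff (k := u), hd]
      rw [← gLeL_mul_right_zpow_iff hΔ 1, mul_assoc, ← zpow_add] at hgu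
      simpa using hgu
    obtain ⟨c, hc⟩ := hdΔ
    rw [← map_mul] at hc
    intro x hx
    rcases List.mem_append.mp hx with hx | hx
    · exact hl x hx
    · rw [List.mem_singleton.mp hx]
      exact ⟨d, ⟨c, hφ.injective hc⟩, rfl⟩

theorem gLeL_pow_of_word (hΔ : IsGarsideElement Δ) {l : List G}
    (hl : ∀ x ∈ l, x ∈ simpleElements φ Δ ∪ (simpleElements φ Δ)⁻¹) :
    ∃ a b : ℕ, a + b = l.length ∧ GLeL φ l.prod (φ Δ ^ (a : ℤ)) ∧
      GLeL φ l.prod⁻¹ (φ Δ ^ (b : ℤ)) := by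
  have hsimple : ∀ x ∈ simpleElements φ Δ, GLeL φ x (φ Δ ^ (1 : ℤ)) ∧
      GLeL φ x⁻¹ (φ Δ ^ (0 : ℤ)) := by
    rintro _ ⟨d, ⟨c, hc⟩, rfl⟩
    exact ⟨⟨c, by rw [← map_mul, hc, zpow_one]⟩, ⟨d, by simp⟩⟩
  induction l with
  | nil => exact ⟨0, 0, by simpa using gLeL_refl (φ := φ) (1 : G)⟩
  | cons x l ih =>
    obtain ⟨a, b, hab, ha, hb⟩ := ih fun y hy => hl y (List.mem_cons_of_mem x hy)
    rw [List.prod_cons, mul_inv_rev]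
    rcases hl x List.mem_cons_self with hx | hx
    · obtain ⟨h1, h2⟩ := hsimple x hx
      refine ⟨a + 1, b, by simp; omega, ?_, ?_⟩
      · simpa [add_comm] using h1.mul_zpow hΔ ha
      · simpa using hb.mul_zpow hΔ h2
    · obtain ⟨h1, h2⟩ := hsimple x⁻¹ hx
      rw [inv_inv] at h2
      refine ⟨a, b + 1, by simp; omega, ?_, ?_⟩
      · simpa using h2.mul_zpow hΔ ha
      · simpa using hb.mul_zpow hΔ h1

/-- With `u = g ∨ 1`, the fraction `g = u * (g⁻¹ * u)⁻¹` has numerator and denominator of the two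
stated lengths. Conversely, the positive letters of a word bound `sup g` and the negative ones bound
`sup g⁻¹`. -/
theorem wordLength_simpleElements [Nontrivial G] (hM : IsGarsideMonoid M)
    (hφ : IsGroupOfFractions φ) (hΔ : IsGarsideElement Δ) (g : G) :
    (wordLength (simpleElements φ Δ) g : ℤ) = max (sup φ Δ g) 0 + max (sup φ Δ g⁻¹) 0 := by
  set S := {k : ℕ | ∃ l : List G, (∀ x ∈ l, x ∈ simpleElements φ Δ ∪ (simpleElements φ Δ)⁻¹) ∧
    l.prod = g ∧ l.length = k}
  set A := (sup φ Δ g).toNat with hA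
  set B := (sup φ Δ g⁻¹).toNat with hB
  have hAB : A + B ∈ S := by
    have hgA : GLeL φ g (φ Δ ^ (A : ℤ)) :=
      (sup_le_iff_gLeL hM hφ hΔ).mp (Int.self_le_toNat _)
    have hgB : GLeL φ g⁻¹ (φ Δ ^ (B : ℤ)) :=
      (sup_le_iff_gLeL hM hφ hΔ).mp (Int.self_le_toNat _)
    obtain ⟨u, hgu, h1u, hu⟩ := hM.exists_gLeL_join hφ hΔ g 1
    have huA : GLeL φ u (φ Δ ^ (A : ℤ)) :=
      hu _ hgA (by simpa using zpow_gLeL_zpow (φ := φ) (Δ := Δ) (Nat.cast_nonneg A))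
    have huB : GLeL φ (g⁻¹ * u) (φ Δ ^ (B : ℤ)) := by
      rw [← gLeL_mul_left_iff (k := g), mul_inv_cancel_left]
      refine hu _ ⟨Δ ^ B, by simp⟩ ?_
      rw [← gLeL_mul_left_iff (k := g⁻¹)]
      simpa using hgB
    obtain ⟨l, hl, hprod, hlen⟩ := exists_simple_list hM hφ hΔ A h1u huA
    obtain ⟨l', hl', hprod', hlen'⟩ := exists_simple_list hM hφ hΔ B
      ((gLeL_mul_left_iff (k := g)).mp (by simpa using hgu)) huB
    refine ⟨l ++ (l'.map (·⁻¹)).reverse, ?_, ?_, by simp [hlen, hlen']⟩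
    · intro x hx
      rcases List.mem_append.mp hx with hx | hx
      · exact Or.inl (hl x hx)
      · rw [List.mem_reverse, List.mem_map] at hx
        obtain ⟨y, hy, rfl⟩ := hx
        exact Or.inr (by simpa using hl' y hy)
    · rw [List.prod_append, hprod, ← List.prod_inv_reverse, hprod']
      group
  have hle : wordLength (simpleElements φ Δ) g ≤ A + B := Nat.sInf_le hAB
  obtain ⟨l, hl, hprod, hlen⟩ : wordLength (simpleElements φ Δ) g ∈ S := Nat.sInf_mem ⟨_, hAB⟩
  obtain ⟨a, b, hab, ha, hb⟩ := gLeL_pow_of_word hΔ hl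
  rw [hprod, ← sup_le_iff_gLeL hM hφ hΔ] at ha hb
  omega

theorem periodicallyGeodesic_of_sup_pow [Nontrivial G] (hM : IsGarsideMonoid M)
    (hφ : IsGroupOfFractions φ) (hΔ : IsGarsideElement Δ) {h : G}
    (h1 : ∀ k : ℕ, sup φ Δ (h ^ k) = k * sup φ Δ h)
    (h2 : ∀ k : ℕ, sup φ Δ (h⁻¹ ^ k) = k * sup φ Δ h⁻¹) :
    PeriodicallyGeodesic (simpleElements φ Δ) h := by
  have key : ∀ k : ℕ, (max (sup φ Δ (h ^ k)) 0 + max (sup φ Δ (h ^ k)⁻¹) 0 : ℤ) =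
      k * (max (sup φ Δ h) 0 + max (sup φ Δ h⁻¹) 0) := by
    intro k
    have hk : (0 : ℤ) ≤ k := Nat.cast_nonneg k
    rw [← inv_pow, h1, h2, mul_add, mul_max_of_nonneg _ _ hk, mul_max_of_nonneg _ _ hk, mul_zero]
  intro k
  zify
  rw [wordLength_simpleElements hM hφ hΔ, wordLength_simpleElements hM hφ hΔ]
  obtain ⟨n, rfl | rfl⟩ := k.eq_nat_or_neg
  · rw [zpow_natCast, key]
    simp
  · rw [zpow_neg, inv_inv, zpow_natCast, add_comm, key]
    simp

end Group

end Garside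

theorem theorem4p2 {M G : Type*} [Monoid M] [Group G] [Nontrivial G]
    (hM : Garside.IsGarsideMonoid M)
    (φ : M →* G) (hφ : Garside.IsGroupOfFractions φ)
    (Δ : M) (hΔ : Garside.IsGarsideElement Δ)
    (N : ℕ) (hN : Garside.norm Δ = (N : ℕ∞)) (g : G) :
    ∃ n : ℕ, 0 < n ∧ n ≤ N ^ 2 ∧
      ∀ h ∈ Garside.superSummitSet φ Δ (g ^ n),
        Garside.PeriodicallyGeodesic (Garside.simpleElements φ Δ) h := by
  obtain ⟨q, hq, hqN, hsup⟩ := Garside.exists_sup_pow_eq hM hφ hΔ hN g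
  obtain ⟨q', hq', hqN', hinf⟩ := Garside.exists_sup_pow_eq hM hφ hΔ hN g⁻¹
  have hn : 0 < q * q' := Nat.mul_pos hq hq'
  refine ⟨q * q', hn, by rw [sq]; exact Nat.mul_le_mul hqN hqN', ?_⟩
  rintro h ⟨hconj, ⟨-, hmax⟩, ⟨-, hmin⟩⟩
  refine Garside.periodicallyGeodesic_of_sup_pow hM hφ hΔ
    (hsup _ hn (dvd_mul_right q q') h hconj fun y hy => hmin ⟨y, hy, rfl⟩)
    (hinf _ hn (dvd_mul_left q' q) h⁻¹ ?_ fun y hy => ?_)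
  · rw [inv_pow]
    exact Garside.conjugatesOf_inv hconj
  -- Since `inf x = -sup x⁻¹`, maximality of `inf h` says that `h⁻¹` minimises `sup` on its class.
  · rw [inv_pow] at hy
    have hy' := Garside.conjugatesOf_inv hy
    rw [inv_inv] at hy'
    have := hmax ⟨y⁻¹, hy', rfl⟩
    rwa [Garside.inf_eq_neg_sup_inv hM hφ hΔ, Garside.inf_eq_neg_sup_inv hM hφ hΔ, inv_inv,
      neg_le_neg_iff] at this
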